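/- For a finite lattice $M$ and $x \in M$, let $\mathsf{Pop}_M(x)$ be the meet of $x$ and all elements covered by $x$, and let $$\mathsf{Pop}(M;q) = \sum_{b \in \mathsf{Pop}_M(M)} q^{|\mathscr{U}_M(b)|},$$ where $\mathscr{U}_M(b)$ is the set of elements of $M$ that cover $b$ and the sum is over the image of $\mathsf{Pop}_M$. Let $\Phi^+_{B_n}$ be the root poset of type $B_n$: its elements are the positive roots $e_i$ $(1 \le i \le n)$ and $e_i \pm e_j$ $(1 \le i < j \le n)$, and $\alpha \le \beta$ if and only if $\beta - \alpha$ is a nonnegative integer combination of the simple roots $e_1 - e_2, \ldots, e_{n-1} - e_n, e_n$ (for $n = 0$ it is empty). Let $J(\Phi^+_{B_n})$ be the lattice of order ideals (down-sets) of $\Phi^+_{B_n}$, ordered by inclusion. **Theorem.** As formal power series in $x$ with coefficients in $\mathbb{Z}[y]$, $$\sum_{n \ge 0} \mathsf{Pop}(J(\Phi^+_{B_n}); y)\, x^n = (w^2 + 4z)^{-1/2}, \qquad z = \frac{xy}{x-1}, \quad w = xy + 1,$$ where $(w^2+4z)^{-1/2}$ is the formal power series with constant term $1$ whose square is the inverse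 of $w^2+4z$. Moreover, for all $0 \le k \le n$, the coefficient of $x^n y^k$ in this series, i.e. the coefficient of $q^k$ in $\mathsf{Pop}(J(\Phi^+_{B_n}); q)$, is $$\sum_{j=0}^{k} (-1)^{k-j} \binom{2j}{j} \binom{k+j}{k-j} \binom{n-k+j-1}{n-k},$$ where $\binom{-1}{0} = 1$; and it is $0$ for $k > n$. -/

import Mathlib

/-! ### The pop operator of a finite lattice -/

/-- The pop operator: `x` is sent to the meet of `x` and all the elements that `x` covers. -/
def popMap {M : Type*} [CompleteLattice M] (x : M) : M :=
  sInf (insert x {y | y ⋖ x})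

/-- `Pop(M; q) = ∑ q ^ #{u | u covers b}`, where `b` runs over the image of the pop operator of
the finite lattice `M`. -/
noncomputable def popPoly (M : Type*) [CompleteLattice M] [Finite M] : Polynomial ℤ :=
  ∑ b ∈ (Set.toFinite (Set.range (popMap (M := M)))).toFinset,
    Polynomial.X ^ Set.ncard {u : M | b ⋖ u}

/-! ### The root poset of type B -/

/-- The positive roots of type `B_n` in `ℤⁿ`: the vectors `e_i`, and `e_i - e_j`, `e_i + e_j`
for `i < j`. -/
def IsPosRootB (n : ℕ) (v : Fin n → ℤ) : Prop :=
  (∃ i, v = Pi.single i 1) ∨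
    ∃ i j, i < j ∧ (v = Pi.single i 1 - Pi.single j 1 ∨ v = Pi.single i 1 + Pi.single j 1)

/-- The simple roots of type `B_n`: `e_i - e_{i+1}` for `i` not the last index, and `e_i` for the
last index `i`. -/
def simpleRootB (n : ℕ) (i : Fin n) : Fin n → ℤ :=
  if h : (i : ℕ) + 1 < n then Pi.single i 1 - Pi.single ⟨i + 1, h⟩ 1 else Pi.single i 1

/-- The set `Φ⁺_{B_n}` of positive roots of type `B_n`. -/
def PosRootB (n : ℕ) : Type := {v : Fin n → ℤ // IsPosRootB n v}

/-- Every simple root has height one. -/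
theorem sum_height_simpleRootB (n : ℕ) (i : Fin n) :
    ∑ j : Fin n, ((n : ℤ) - (j : ℕ)) * simpleRootB n i j = 1 := by
  unfold simpleRootB
  split_ifs with h
  · simp [mul_sub, Finset.sum_sub_distrib, Pi.single_apply]
  · have : (n : ℤ) = (i : ℕ) + 1 := by have := i.2; omega
    simp [Pi.single_apply, this]

theorem sum_height_combination (n : ℕ) (c : Fin n → ℕ) :
    ∑ j : Fin n, ((n : ℤ) - (j : ℕ)) * (∑ i, c i • simpleRootB n i) j = ∑ i, (c i : ℤ) := by
  simp only [Finset.sum_apply, Pi.smul_apply, Finset.mul_sum]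
  rw [Finset.sum_comm]
  refine Finset.sum_congr rfl fun i _ => ?_
  have h := congrArg (fun t => (c i : ℤ) * t) (sum_height_simpleRootB n i)
  simp only [Finset.mul_sum, mul_one] at h
  rw [← h]
  refine Finset.sum_congr rfl fun j _ => ?_
  rw [nsmul_eq_mul]
  ring

/-- The root poset: `α ≤ β` if `β - α` is a combination of simple roots with nonnegative integer
coefficients. -/
instance instPartialOrderPosRootB (n : ℕ) : PartialOrder (PosRootB n) where
  le α β := ∃ c : Fin n → ℕ, β.1 - α.1 = ∑ i, c i • simpleRootB n i
  le_refl α := ⟨0, by simp⟩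
  le_trans α β γ := by
    rintro ⟨c, hc⟩ ⟨d, hd⟩
    refine ⟨c + d, ?_⟩
    simp only [Pi.add_apply, add_smul, Finset.sum_add_distrib]
    rw [← hc, ← hd]
    abel
  le_antisymm α β := by
    rintro ⟨c, hc⟩ ⟨d, hd⟩
    have h0 : ∑ i, (c + d) i • simpleRootB n i = 0 := by
      simp only [Pi.add_apply, add_smul, Finset.sum_add_distrib]
      rw [← hc, ← hd]
      abel
    have h1 := sum_height_combination n (c + d)
    rw [h0] at h1
    simp only [Pi.zero_apply, mul_zero, Finset.sum_const_zero] at h1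
    have h2 : ∀ i, c i = 0 := by
      intro i
      have h3 := (Finset.sum_eq_zero_iff_of_nonneg
        (fun i _ => Int.natCast_nonneg ((c + d) i))).1 h1.symm i (Finset.mem_univ i)
      have h4 : c i + d i = 0 := by exact_mod_cast h3
      omega
    simp only [h2, zero_smul, Finset.sum_const_zero] at hc
    exact Subtype.ext (sub_eq_zero.1 hc).symm

instance instFinitePosRootB (n : ℕ) : Finite (PosRootB n) := by
  have h : {v : Fin n → ℤ | IsPosRootB n v} ⊆ Set.pi Set.univ (fun _ => Set.Icc (-1 : ℤ) 1) := by
    rintro v (⟨i, rfl⟩ | ⟨i, j, hij, rfl | rfl⟩) k -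
    · simp only [Pi.single_apply, Set.mem_Icc]
      split_ifs <;> omega
    · simp only [Pi.sub_apply, Pi.single_apply, Set.mem_Icc]
      split_ifs <;> omega
    · simp only [Pi.add_apply, Pi.single_apply, Set.mem_Icc]
      split_ifs <;> omega
  exact ((Set.Finite.pi' fun _ => Set.finite_Icc (-1 : ℤ) 1).subset
    fun v hv k => h hv k (Set.mem_univ k)).to_subtype

/-- `Pop(J(Φ⁺_{B_n}); q)`, where `J(P)` is the lattice of order ideals (lower sets) of `P`. -/
noncomputable def popJB (n : ℕ) : Polynomial ℤ := popPoly (LowerSet (PosRootB n))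

/-! ### The generating function -/

/-- The generating function `∑ₙ Pop(J(Φ⁺_{B_n}); y) xⁿ` in `ℤ[y]⟦x⟧`. -/
noncomputable def popJBSeries : PowerSeries (Polynomial ℤ) := PowerSeries.mk popJB

/-- `G = F ^ (-1/2)` as formal power series: `G` has constant term `1`, and its square is the
multiplicative inverse of `F`. -/
def IsInvSqrt {R : Type*} [CommRing R] (F G : PowerSeries R) : Prop :=
  PowerSeries.constantCoeff G = 1 ∧ G ^ 2 * F = 1

/-- The series `F ^ (-1/2)` is unique. -/
theorem IsInvSqrt.unique {R : Type*} [CommRing R] [IsDomain R] [CharZero R]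
    {F G H : PowerSeries R} (hG : IsInvSqrt F G) (hH : IsInvSqrt F H) : G = H := by
  obtain ⟨hG0, hG⟩ := hG
  obtain ⟨hH0, hH⟩ := hH
  have h : (G - H) * (G + H) = 0 := by
    linear_combination H ^ 2 * hG - G ^ 2 * hH
  rcases mul_eq_zero.1 h with h | h
  · exact sub_eq_zero.1 h
  · have h2 := congrArg PowerSeries.constantCoeff h
    rw [map_add, hG0, hH0, map_zero, one_add_one_eq_two] at h2
    exact absurd h2 two_ne_zero

/-- The variable `x` of `ℤ[y]⟦x⟧`. -/
noncomputable def serX : PowerSeries (Polynomial ℤ) := PowerSeries.X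

/-- The variable `y` of `ℤ[y]⟦x⟧`. -/
noncomputable def serY : PowerSeries (Polynomial ℤ) := PowerSeries.C Polynomial.X

/-- `z = x y / (x - 1)`; the series `x - 1` is a unit (see `isUnit_serX_sub_one`). -/
noncomputable def serZ : PowerSeries (Polynomial ℤ) := serX * serY * Ring.inverse (serX - 1)

/-- `w = x y + 1`. -/
noncomputable def serW : PowerSeries (Polynomial ℤ) := serX * serY + 1

theorem isUnit_serX_sub_one : IsUnit (serX - 1) := by
  rw [PowerSeries.isUnit_iff_constantCoeff]
  simp [serX]

/-!
The pop operator on the lattice of lower sets of a finite poset `P` removes all the maximal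
elements. Hence a lower set `b` is in its image if and only if every element of `P` is comparable
to a minimal element of the complement of `b`. Those minimal elements form an antichain, which
determines `b` and counts the covers of `b`; so `Pop(J(P); q) = ∑ q ^ #A` over the maximal
antichains `A` of `P` (`popPoly_lowerSet`).

The positive roots of type `B_n` correspond to the integer points `(a, c)` with `1 ≤ a ≤ c` and
`a + c ≤ 2 n`, and the root order is `a' ≤ a`, `c ≤ c'` (`pairRoot_le_iff`). Two roots are
incomparable if and only if both coordinates of one are smaller than those of the other. So a
maximal antichain is a sequence of points which starts with a step from `(0, 0)`, in which both
coordinates increase in each step, one of them by exactly `1`, and which ends with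
`a + c ∈ {2 n - 1, 2 n}` (`mem_maxChains_iff`).

Let `H_h` be the generating function of such sequences ending at height `c - a = h`, with `xᵃ`
marking the end point and `y` the number of points. Splitting off the last step gives
`x H_{h+1} + H_{h-1} = B H_h` with `B = 1 + x - x y (1 - x)`, apart from the boundary
(`heightSeries_rec`). The partial sums of the `H_h`, preceded by `1`, satisfy the recursion without
exception. Its quadratic invariant is divisible by all powers of `x`, thus zero, which gives
`x H_0² - B H_0 + 1 = 0` (`heightSeries_zero_quadratic`). The series `G` in question is
`∑ₕ x ^ ⌈h / 2⌉ H_h`; summing the recursion over the even and the odd heights expresses it by `H_0`: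
`G (4 x - B²) = (1 - x) (2 x H_0 - B)` (`popJBSeries_mul`). Squaring and using the quadratic equation
gives `G² (B² - 4 x) = (1 - x)²`, and `B² - 4 x = (1 - x)² (w² + 4 z)`.

The coefficients are read off from the binomial expansion
`w⁻¹ (1 + 4 z / w²) ^ (-1/2) = ∑ⱼ (2j choose j) (-z)ʲ w ^ (-2j-1)`
(`popJBSeries_eq_diagSum`).
-/

/-! ### The pop operator on lower sets -/

theorem LowerSet.coe_sup_Iic_of_minimal {P : Type*} [PartialOrder P] {b : LowerSet P}
    {p : P} (hp : Minimal (· ∉ b) p) :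
    ((b ⊔ LowerSet.Iic p : LowerSet P) : Set P) = insert p (b : Set P) := by
  ext r
  simp only [LowerSet.coe_sup, LowerSet.coe_Iic, Set.mem_union, Set.mem_Iic, Set.mem_insert_iff,
    SetLike.mem_coe]
  constructor
  · rintro (h | h)
    · exact Or.inr h
    · by_contra! hr
      exact hr.1 (le_antisymm h (hp.2 hr.2 h))
  · rintro (rfl | h)
    · exact Or.inr le_rfl
    · exact Or.inl h

section Pop

variable {P : Type*} [PartialOrder P] [Finite P]

/-- The covers of a lower set are obtained by adding one minimal element of the complement. -/
theorem LowerSet.covBy_iff_exists_minimal {b u : LowerSet P} :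
    b ⋖ u ↔ ∃ p, Minimal (· ∉ b) p ∧ b ⊔ LowerSet.Iic p = u := by
  constructor
  · intro h
    obtain ⟨p, ⟨hpu, hpb⟩, hmin⟩ :=
      (Set.toFinite {p | p ∈ u ∧ p ∉ b}).exists_minimal
        (Set.exists_of_ssubset (LowerSet.coe_ssubset_coe.2 h.lt))
    have hp : Minimal (· ∉ b) p := ⟨hpb, fun r hr hrp => hmin ⟨u.lower hrp hpu, hr⟩ hrp⟩
    have hle : b ⊔ LowerSet.Iic p ≤ u := sup_le h.le (LowerSet.Iic_le.2 hpu)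
    refine ⟨p, hp, (h.eq_or_eq le_sup_left hle).resolve_left fun he => hpb ?_⟩
    rw [← he]
    exact Or.inr le_rfl
  · rintro ⟨p, hp, rfl⟩
    refine ⟨lt_of_le_of_ne le_sup_left fun he => hp.1 ?_, fun c hbc hcu => ?_⟩
    · rw [he]
      exact Or.inr le_rfl
    · obtain ⟨r, hrc, hrb⟩ := Set.exists_of_ssubset (LowerSet.coe_ssubset_coe.2 hbc)
      have hr : r ∈ ((b ⊔ LowerSet.Iic p : LowerSet P) : Set P) := hcu.le hrc
      rw [LowerSet.coe_sup_Iic_of_minimal hp] at hr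
      obtain rfl := hr.resolve_right hrb
      exact hcu.not_ge (sup_le hbc.le (LowerSet.Iic_le.2 hrc))

theorem ncard_covers_lowerSet (b : LowerSet P) :
    Set.ncard {u | b ⋖ u} = Set.ncard {p | Minimal (· ∉ b) p} := by
  have h : {u | b ⋖ u} = (fun p => b ⊔ LowerSet.Iic p) '' {p | Minimal (· ∉ b) p} := by
    ext u
    simp [LowerSet.covBy_iff_exists_minimal]
  rw [h, Set.InjOn.ncard_image]
  intro p hp q hq hpq
  have hq' : p ∈ ((b ⊔ LowerSet.Iic q : LowerSet P) : Set P) := by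
    have : b ⊔ LowerSet.Iic p = b ⊔ LowerSet.Iic q := hpq
    rw [← this]
    exact Or.inr le_rfl
  rw [LowerSet.coe_sup_Iic_of_minimal hq] at hq'
  exact hq'.resolve_right hp.1

/-- The pop operator on lower sets removes all the maximal elements. -/
theorem mem_popMap_lowerSet {x : LowerSet P} {p : P} :
    p ∈ popMap x ↔ p ∈ x ∧ ∃ q ∈ x, p < q := by
  simp only [popMap, LowerSet.mem_sInf_iff, Set.mem_insert_iff, Set.mem_ofPred_eq,
    forall_eq_or_imp]
  refine and_congr_right fun hpx => ⟨fun h => ?_, ?_⟩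
  · by_contra! hmax
    let y : LowerSet P := ⟨(x : Set P) \ {p}, fun a c hca ha => ⟨x.lower hca ha.1, by
      rintro rfl
      exact ha.2 (by_contra fun hne => hmax a ha.1 (lt_of_le_of_ne hca fun h => hne h.symm))⟩⟩
    have hpy : p ∉ y := fun h => h.2 rfl
    refine hpy (h y (LowerSet.covBy_iff_exists_minimal.2 ⟨p, ⟨hpy, fun r hr hrp => ?_⟩, ?_⟩))
    · by_contra hne
      exact hr ⟨x.lower hrp hpx, fun h => hne (le_of_eq h.symm)⟩
    · refine le_antisymm (sup_le (fun r hr => hr.1) (LowerSet.Iic_le.2 hpx)) fun r hr => ?_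
      by_cases hrp : r = p
      · exact Or.inr (le_of_eq hrp)
      · exact Or.inl ⟨hr, hrp⟩
  · rintro ⟨q, hqx, hpq⟩ y hy
    obtain ⟨r, hr, rfl⟩ := LowerSet.covBy_iff_exists_minimal.1 hy
    have hp' : p ∈ ((y ⊔ LowerSet.Iic r : LowerSet P) : Set P) := hpx
    have hq' : q ∈ ((y ⊔ LowerSet.Iic r : LowerSet P) : Set P) := hqx
    rw [LowerSet.coe_sup_Iic_of_minimal hr] at hp' hq'
    rcases hp' with rfl | hp'
    · exact y.lower hpq.le (hq'.resolve_left hpq.ne')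
    · exact hp'

/-- A lower set is in the image of the pop operator if and only if every element is comparable
to a minimal element of its complement. -/
theorem mem_range_popMap_lowerSet {b : LowerSet P} :
    b ∈ Set.range (popMap (M := LowerSet P)) ↔
      ∀ p, ∃ a, Minimal (· ∉ b) a ∧ (p ≤ a ∨ a ≤ p) := by
  constructor
  · rintro ⟨x, rfl⟩ p
    by_cases hp : p ∈ popMap x
    · obtain ⟨hpx, q, hqx, hpq⟩ := mem_popMap_lowerSet.1 hp
      obtain ⟨m, hqm, hm⟩ := (Set.toFinite (x : Set P)).exists_le_maximal hqx
      refine ⟨m, ⟨fun h => ?_, fun r hr hrm => ?_⟩, Or.inl (hpq.le.trans hqm)⟩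
      · obtain ⟨-, s, hs, hms⟩ := mem_popMap_lowerSet.1 h
        exact hms.not_ge (hm.2 hs hms.le)
      · by_contra hne
        exact hr (mem_popMap_lowerSet.2
          ⟨x.lower hrm hm.1, m, hm.1, lt_of_le_not_ge hrm hne⟩)
    · obtain ⟨m, hmp, hm⟩ := (Set.toFinite {r | r ∉ popMap x}).exists_le_minimal hp
      exact ⟨m, hm, Or.inr hmp⟩
  · intro h
    refine ⟨⟨{p | p ∈ b ∨ Minimal (· ∉ b) p}, fun a c hca ha => ?_⟩, ?_⟩
    · rcases ha with ha | ha
      · exact Or.inl (b.lower hca ha)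
      · by_cases hc : c ∈ b
        · exact Or.inl hc
        · rw [le_antisymm hca (ha.2 hc hca)]
          exact Or.inr ha
    · ext p
      refine mem_popMap_lowerSet.trans ⟨?_, fun hp => ⟨Or.inl hp, ?_⟩⟩
      · rintro ⟨-, q, hq | hq, hpq⟩
        · exact b.lower hpq.le hq
        · by_contra hp
          exact hpq.not_ge (hq.2 hp hpq.le)
      · obtain ⟨a, ha, hpa | hpa⟩ := h p
        · refine ⟨a, Or.inr ha, lt_of_le_of_ne hpa ?_⟩
          rintro rfl
          exact ha.1 hp
        · exact absurd (b.lower hpa hp) ha.1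

/-- The antichains which are maximal, in the sense that every element is comparable to one of
their elements. -/
def maxAntichains (P : Type*) [PartialOrder P] : Set (Set P) :=
  {A | IsAntichain (· ≤ ·) A ∧ ∀ p, ∃ a ∈ A, p ≤ a ∨ a ≤ p}

/-- Sending a lower set to the minimal elements of its complement, one obtains
`Pop(J(P); q) = ∑ q ^ #A`, where `A` runs over the maximal antichains of `P`. -/
theorem popPoly_lowerSet :
    popPoly (LowerSet P) = ∑ᶠ A ∈ maxAntichains P, Polynomial.X ^ A.ncard := by
  rw [popPoly, ← finsum_mem_eq_finite_toFinset_sum]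
  refine finsum_mem_eq_of_bijOn (fun b : LowerSet P => {p | Minimal (· ∉ b) p})
    ⟨fun b hb => ?_, fun b _ c _ h => ?_, fun A hA => ?_⟩
    fun b _ => by rw [ncard_covers_lowerSet]
  · refine ⟨fun p hp q hq hne hpq => ?_, mem_range_popMap_lowerSet.1 hb⟩
    exact hne (le_antisymm hpq (hq.2 hp.1 hpq))
  · have key : ∀ (b : LowerSet P) p, p ∉ b ↔ ∃ a, Minimal (· ∉ b) a ∧ a ≤ p := by
      refine fun b p => ⟨fun hp => ?_, fun ⟨a, ha, hap⟩ hp => ha.1 (b.lower hap hp)⟩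
      obtain ⟨m, hmp, hm⟩ := (Set.toFinite {r | r ∉ b}).exists_le_minimal hp
      exact ⟨m, hm, hmp⟩
    have h' : ∀ a, Minimal (· ∉ b) a ↔ Minimal (· ∉ c) a := fun a => Set.ext_iff.1 h a
    ext p
    have h1 := key b p
    have h2 := key c p
    simp only [h'] at h1
    exact not_iff_not.1 (h1.trans h2.symm)
  · let b : LowerSet P := ⟨{p | ¬ ∃ a ∈ A, a ≤ p}, fun p q hqp hp ⟨a, ha, haq⟩ =>
      hp ⟨a, ha, haq.trans hqp⟩⟩
    have hb : ∀ p, p ∉ b ↔ ∃ a ∈ A, a ≤ p := fun p => not_not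
    have hmin : ∀ p, Minimal (· ∉ b) p ↔ p ∈ A := by
      refine fun p => ⟨fun hp => ?_, fun hp => ⟨(hb p).2 ⟨p, hp, le_rfl⟩, fun r hr hrp => ?_⟩⟩
      · obtain ⟨a, ha, hap⟩ := (hb p).1 hp.1
        rwa [le_antisymm (hp.2 ((hb a).2 ⟨a, ha, le_rfl⟩) hap) hap]
      · obtain ⟨a, ha, har⟩ := (hb r).1 hr
        rwa [← hA.1.eq ha hp (har.trans hrp)]
    refine ⟨b, mem_range_popMap_lowerSet.2 fun p => ?_, Set.ext hmin⟩
    obtain ⟨a, ha, h⟩ := hA.2 p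
    exact ⟨a, (hmin a).2 ha, h⟩

end Pop

/-! ### Coordinates for the roots of type B -/

/-- The integer points `(a, c)` with `1 ≤ a ≤ c` and `a + c ≤ 2 n`, which are coordinates for the
positive roots of type `B_n`. -/
def rootPairs (n : ℕ) : Set (ℕ × ℕ) := {p | 1 ≤ p.1 ∧ p.1 ≤ p.2 ∧ p.1 + p.2 ≤ 2 * n}

/-- The vector with coordinates `(a, c)`: with `e_1, …, e_n` the standard basis, it is
`e_a - e_{c+1}` for `c < n`, `e_a` for `c = n`, and `e_a + e_{2n-c+1}` for `c > n`. -/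
def pairVec (n : ℕ) (p : ℕ × ℕ) (j : Fin n) : ℤ :=
  (if (j : ℕ) = p.1 - 1 then 1 else 0) - (if (j : ℕ) = p.2 then 1 else 0) +
    if (j : ℕ) = 2 * n - p.2 then 1 else 0

theorem isPosRootB_pairVec {n : ℕ} {p : ℕ × ℕ} (hp : p ∈ rootPairs n) :
    IsPosRootB n (pairVec n p) := by
  obtain ⟨a, c⟩ := p
  obtain ⟨h1, h2, h3⟩ : 1 ≤ a ∧ a ≤ c ∧ a + c ≤ 2 * n := hp
  have ha : a - 1 < n := by omega
  rcases lt_trichotomy c n with hc | hc | hc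
  · refine Or.inr ⟨⟨a - 1, ha⟩, ⟨c, hc⟩, Fin.mk_lt_mk.2 (by omega), Or.inl (funext fun j => ?_)⟩
    have := j.2
    simp only [pairVec, Pi.sub_apply, Pi.single_apply, Fin.ext_iff]
    split_ifs <;> omega
  · refine Or.inl ⟨⟨a - 1, ha⟩, funext fun j => ?_⟩
    have := j.2
    simp only [pairVec, Pi.single_apply, Fin.ext_iff]
    split_ifs <;> omega
  · refine Or.inr ⟨⟨a - 1, ha⟩, ⟨2 * n - c, by omega⟩, Fin.mk_lt_mk.2 (by omega),
      Or.inr (funext fun j => ?_)⟩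
    have := j.2
    simp only [pairVec, Pi.add_apply, Pi.single_apply, Fin.ext_iff]
    split_ifs <;> omega

theorem exists_pairVec_eq {n : ℕ} {v : Fin n → ℤ} (hv : IsPosRootB n v) :
    ∃ p ∈ rootPairs n, pairVec n p = v := by
  rcases hv with ⟨i, rfl⟩ | ⟨i, j, hij, rfl | rfl⟩
  · refine ⟨(i + 1, n), ⟨?_, ?_, ?_⟩, funext fun k => ?_⟩
    any_goals (have := i.2; dsimp only; omega)
    have := k.2
    simp only [pairVec, Pi.single_apply, Fin.ext_iff]
    split_ifs <;> omega
  · rw [Fin.lt_def] at hij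
    refine ⟨(i + 1, j), ⟨?_, ?_, ?_⟩, funext fun k => ?_⟩
    any_goals (have := j.2; dsimp only; omega)
    have := k.2
    have := j.2
    simp only [pairVec, Pi.sub_apply, Pi.single_apply, Fin.ext_iff]
    split_ifs <;> omega
  · rw [Fin.lt_def] at hij
    refine ⟨(i + 1, 2 * n - j), ⟨?_, ?_, ?_⟩, funext fun k => ?_⟩
    any_goals (have := j.2; dsimp only; omega)
    have := k.2
    have := j.2
    simp only [pairVec, Pi.add_apply, Pi.single_apply, Fin.ext_iff]
    split_ifs <;> omega

theorem sum_Iic_ite_eq {n : ℕ} (k : Fin n) (m : ℕ) :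
    ∑ j ∈ Finset.Iic k, (if (j : ℕ) = m then (1 : ℤ) else 0) = if m ≤ k then 1 else 0 := by
  split_ifs with h
  · have : ∀ j : Fin n, (j : ℕ) = m ↔ j = ⟨m, h.trans_lt k.2⟩ := fun j => by simp [Fin.ext_iff]
    simp only [this]
    rw [Finset.sum_ite_eq', if_pos (Finset.mem_Iic.2 (Fin.mk_le_of_le_val h))]
  · refine Finset.sum_eq_zero fun j hj => if_neg ?_
    have : j ≤ k := Finset.mem_Iic.1 hj
    rw [Fin.le_def] at this
    omega

/-- The coefficient of a vector at a simple root of type `B_n` is a sum of its first entries. -/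
theorem sum_Iic_simpleRootB {n : ℕ} (k i : Fin n) :
    ∑ j ∈ Finset.Iic k, simpleRootB n i j = if i = k then 1 else 0 := by
  have hs : ∀ (i : Fin n), ∑ j ∈ Finset.Iic k, (Pi.single i 1 : Fin n → ℤ) j =
      if (i : ℕ) ≤ k then 1 else 0 := fun i => by
    rw [← sum_Iic_ite_eq]
    exact Finset.sum_congr rfl fun j _ => by simp only [Pi.single_apply, Fin.ext_iff]
  have hi := i.2
  have hk := k.2
  unfold simpleRootB
  split_ifs with h1 h2 h2
  all_goals
    simp only [Pi.sub_apply, Finset.sum_sub_distrib, hs]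
    rw [Fin.ext_iff] at h2
    split_ifs <;> omega

theorem eq_zero_of_sum_Iic_eq_zero {n : ℕ} {v : Fin n → ℤ}
    (h : ∀ k, ∑ j ∈ Finset.Iic k, v j = 0) : v = 0 := by
  funext k
  induction k using WellFoundedLT.induction with
  | ind k ih =>
    have hk := h k
    rw [← Finset.sum_subset (Finset.singleton_subset_iff.2 (Finset.mem_Iic.2 le_rfl)),
      Finset.sum_singleton] at hk
    · exact hk
    · exact fun j hj hjk => ih j
        (lt_of_le_of_ne (Finset.mem_Iic.1 hj) fun he => hjk (Finset.mem_singleton.2 he))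

/-- The coefficients of a vector in the basis of simple roots are the sums of its first entries, so
the root order compares those sums. -/
theorem exists_simpleRootB_combination_iff {n : ℕ} (v : Fin n → ℤ) :
    (∃ c : Fin n → ℕ, v = ∑ i, c i • simpleRootB n i) ↔ ∀ k, 0 ≤ ∑ j ∈ Finset.Iic k, v j := by
  have key : ∀ (c : Fin n → ℕ) k,
      ∑ j ∈ Finset.Iic k, (∑ i, c i • simpleRootB n i) j = c k := fun c k => by
    simp only [Finset.sum_apply, Pi.smul_apply]
    rw [Finset.sum_comm]
    simp only [← Finset.smul_sum, sum_Iic_simpleRootB]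
    simp
  constructor
  · rintro ⟨c, rfl⟩ k
    rw [key]
    exact Int.natCast_nonneg _
  · intro h
    refine ⟨fun k => (∑ j ∈ Finset.Iic k, v j).toNat, sub_eq_zero.1
      (eq_zero_of_sum_Iic_eq_zero fun k => ?_)⟩
    simp only [Pi.sub_apply, Finset.sum_sub_distrib]
    rw [key, Int.toNat_of_nonneg (h k), sub_self]

theorem sum_Iic_pairVec {n : ℕ} (k : Fin n) (p : ℕ × ℕ) :
    ∑ j ∈ Finset.Iic k, pairVec n p j =
      (if p.1 - 1 ≤ k then 1 else 0) - (if p.2 ≤ k then 1 else 0) +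
        if 2 * n - p.2 ≤ k then 1 else 0 := by
  simp only [pairVec, Finset.sum_add_distrib, Finset.sum_sub_distrib, sum_Iic_ite_eq]

/-- The root with given coordinates. -/
def pairRoot (n : ℕ) (p : rootPairs n) : PosRootB n := ⟨pairVec n p, isPosRootB_pairVec p.2⟩

theorem pairRoot_surjective (n : ℕ) : Function.Surjective (pairRoot n) := by
  rintro ⟨v, hv⟩
  obtain ⟨p, hp, rfl⟩ := exists_pairVec_eq hv
  exact ⟨⟨p, hp⟩, rfl⟩

theorem pairRoot_le_iff {n : ℕ} (p q : rootPairs n) :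
    pairRoot n p ≤ pairRoot n q ↔ q.1.1 ≤ p.1.1 ∧ p.1.2 ≤ q.1.2 := by
  obtain ⟨⟨a, c⟩, hp⟩ := p
  obtain ⟨⟨a', c'⟩, hq⟩ := q
  obtain ⟨h1, h2, h3⟩ : 1 ≤ a ∧ a ≤ c ∧ a + c ≤ 2 * n := hp
  obtain ⟨h1', h2', h3'⟩ : 1 ≤ a' ∧ a' ≤ c' ∧ a' + c' ≤ 2 * n := hq
  refine (exists_simpleRootB_combination_iff _).trans ?_
  simp only [pairRoot, Pi.sub_apply, Finset.sum_sub_distrib, sum_Iic_pairVec]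
  constructor
  · intro h
    have hk : ∀ k < n, (if a - 1 ≤ k then (1 : ℤ) else 0) - (if c ≤ k then 1 else 0) +
        (if 2 * n - c ≤ k then 1 else 0) ≤ (if a' - 1 ≤ k then 1 else 0) -
        (if c' ≤ k then 1 else 0) + if 2 * n - c' ≤ k then 1 else 0 :=
      fun k hk => sub_nonneg.1 (h ⟨k, hk⟩)
    have ha : a' ≤ a := by
      by_contra! ha
      have := hk (a - 1) (by omega)
      rw [if_pos le_rfl, if_neg (show ¬ c ≤ a - 1 by omega),
        if_neg (show ¬ a' - 1 ≤ a - 1 by omega),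
        if_neg (show ¬ 2 * n - c' ≤ a - 1 by omega)] at this
      split_ifs at this <;> omega
    refine ⟨ha, ?_⟩
    by_contra! hc
    -- The sum of the entries up to the `k`-th, for a suitable `k`, is larger for the first vector.
    rcases lt_or_ge c' n with hn | hn
    · have := hk (max c' (a - 1)) (by omega)
      rw [if_pos (le_max_right c' (a - 1)), if_pos (le_max_left c' (a - 1)),
        if_neg (show ¬ c ≤ max c' (a - 1) by omega),
        if_pos (show a' - 1 ≤ max c' (a - 1) by omega),
        if_neg (show ¬ 2 * n - c' ≤ max c' (a - 1) by omega)] at this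
      split_ifs at this <;> omega
    · have := hk (2 * n - c) (by omega)
      rw [if_pos (show a - 1 ≤ 2 * n - c by omega), if_neg (show ¬ c ≤ 2 * n - c by omega),
        if_pos le_rfl, if_pos (show a' - 1 ≤ 2 * n - c by omega),
        if_neg (show ¬ 2 * n - c' ≤ 2 * n - c by omega)] at this
      split_ifs at this <;> omega
  · rintro ⟨ha, hc⟩ k
    have hmono : ∀ {p q : Prop} [Decidable p] [Decidable q], (p → q) →
        (if p then (1 : ℤ) else 0) ≤ if q then 1 else 0 := fun hpq => by
      split_ifs <;> tauto
    have e1 := hmono fun h : a - 1 ≤ k => show a' - 1 ≤ k by omega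
    have e2 := hmono fun h : c' ≤ k => show c ≤ k by omega
    have e3 := hmono fun h : 2 * n - c ≤ k => show 2 * n - c' ≤ k by omega
    linarith

theorem pairRoot_injective (n : ℕ) : Function.Injective (pairRoot n) := fun p q h => by
  have h1 := (pairRoot_le_iff p q).1 h.le
  have h2 := (pairRoot_le_iff q p).1 h.ge
  exact Subtype.ext (Prod.ext (by omega) (by omega))

/-! ### Maximal antichains as sequences of steps -/

/-- The strict product order on pairs: both coordinates increase. For the coordinates of roots, two
roots are incomparable if and only if their coordinates are related in one of the two directions. -/
def StrictBelow (p q : ℕ × ℕ) : Prop := p.1 < q.1 ∧ p.2 < q.2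

/-- The maximal chains of `rootPairs n` for `StrictBelow`. -/
def maxChains (n : ℕ) : Set (Set (ℕ × ℕ)) :=
  {A | A ⊆ rootPairs n ∧ (∀ p ∈ A, ∀ q ∈ A, p ≠ q → StrictBelow p q ∨ StrictBelow q p) ∧
    ∀ r ∈ rootPairs n, ∃ a ∈ A, ¬ StrictBelow r a ∧ ¬ StrictBelow a r}

theorem pairRoot_le_or_ge_iff {n : ℕ} (p q : rootPairs n) :
    (pairRoot n p ≤ pairRoot n q ∨ pairRoot n q ≤ pairRoot n p) ↔
      ¬ StrictBelow p q ∧ ¬ StrictBelow q p := by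
  rw [pairRoot_le_iff, pairRoot_le_iff]
  unfold StrictBelow
  omega

/-- Antichains of roots are chains of coordinates. -/
theorem popJB_eq_finsum_maxChains (n : ℕ) :
    popJB n = ∑ᶠ A ∈ maxChains n, Polynomial.X ^ A.ncard := by
  have hinj := pairRoot_injective n
  have hsurj := pairRoot_surjective n
  rw [popJB, popPoly_lowerSet]
  symm
  refine finsum_mem_eq_of_bijOn (fun A => pairRoot n '' (Subtype.val ⁻¹' A))
    ⟨fun A hA => ⟨?_, fun p => ?_⟩, fun A hA B hB h => ?_, fun A hA => ?_⟩ fun A hA => ?_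
  · rintro _ ⟨p, hp, rfl⟩ _ ⟨q, hq, rfl⟩ hne hle
    obtain ⟨h1, h2⟩ := (pairRoot_le_or_ge_iff p q).1 (Or.inl hle)
    rcases hA.2.1 p hp q hq fun h => hne (by rw [Subtype.ext h]) with h | h
    exacts [h1 h, h2 h]
  · obtain ⟨r, rfl⟩ := hsurj p
    obtain ⟨a, ha, h⟩ := hA.2.2 r r.2
    exact ⟨_, ⟨⟨a, hA.1 ha⟩, ha, rfl⟩, (pairRoot_le_or_ge_iff r ⟨a, hA.1 ha⟩).2 h⟩
  · have h' : Subtype.val ⁻¹' A = (Subtype.val ⁻¹' B : Set (rootPairs n)) :=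
      hinj.image_injective h
    rwa [Subtype.preimage_val_eq_preimage_val_iff, Set.inter_eq_right.2 hA.1,
      Set.inter_eq_right.2 hB.1] at h'
  · refine ⟨Subtype.val '' (pairRoot n ⁻¹' A), ⟨?_, ?_, fun r hr => ?_⟩, ?_⟩
    · rintro _ ⟨p, -, rfl⟩
      exact p.2
    · rintro _ ⟨p, hp, rfl⟩ _ ⟨q, hq, rfl⟩ hne
      by_contra! h
      have hne' : pairRoot n p ≠ pairRoot n q := fun h => hne (congrArg _ (hinj h))
      rcases (pairRoot_le_or_ge_iff p q).2 h with h | h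
      exacts [hA.1 hp hq hne' h, hA.1 hq hp hne'.symm h]
    · obtain ⟨a, ha, h⟩ := hA.2 (pairRoot n ⟨r, hr⟩)
      obtain ⟨s, rfl⟩ := hsurj a
      exact ⟨s, ⟨s, ha, rfl⟩, (pairRoot_le_or_ge_iff ⟨r, hr⟩ s).1 h⟩
    · dsimp only
      rw [Set.preimage_image_eq _ Subtype.val_injective, Set.image_preimage_eq _ hsurj]
  · rw [Set.ncard_image_of_injective _ hinj, Set.ncard_preimage_of_injective_subset_range
      Subtype.val_injective (by rw [Subtype.range_val]; exact hA.1)]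

/-- The steps from one element of a maximal chain to the next: both coordinates increase, and one
of them by exactly `1`. -/
def ChainStep (p q : ℕ × ℕ) : Prop :=
  StrictBelow p q ∧ q.1 ≤ q.2 ∧ (q.1 = p.1 + 1 ∨ q.2 = p.2 + 1)

/-- `SaturatedChain A p` means that `A` is the set of the points reached by a sequence of steps
from `(0, 0)` to `p`. The starting point is not in `A`. -/
inductive SaturatedChain : Set (ℕ × ℕ) → ℕ × ℕ → Prop
  | empty : SaturatedChain ∅ (0, 0)
  | step {A : Set (ℕ × ℕ)} {p q : ℕ × ℕ} (hA : SaturatedChain A p) (hpq : ChainStep p q) :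
      SaturatedChain (insert q A) q

namespace SaturatedChain

variable {A : Set (ℕ × ℕ)} {p q : ℕ × ℕ}

theorem eq_or_strictBelow (h : SaturatedChain A p) {r : ℕ × ℕ} (hr : r ∈ A) :
    r = p ∨ StrictBelow r p := by
  induction h with
  | empty => exact absurd hr (Set.notMem_empty r)
  | step hA hpq ih =>
    rcases hr with rfl | hr
    · exact Or.inl rfl
    · rcases ih hr with rfl | h
      · exact Or.inr hpq.1
      · exact Or.inr ⟨h.1.trans hpq.1.1, h.2.trans hpq.1.2⟩

theorem eq_empty_or_mem (h : SaturatedChain A p) : A = ∅ ∧ p = (0, 0) ∨ p ∈ A := by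
  cases h with
  | empty => exact Or.inl ⟨rfl, rfl⟩
  | step hA hpq => exact Or.inr (Set.mem_insert _ _)

theorem fst_le_snd (h : SaturatedChain A p) : p.1 ≤ p.2 := by
  cases h with
  | empty => exact le_rfl
  | step hA hpq => exact hpq.2.1

theorem end_unique (h : SaturatedChain A p) (h' : SaturatedChain A q) : p = q := by
  rcases h.eq_empty_or_mem with ⟨rfl, rfl⟩ | hp
  · rcases h'.eq_empty_or_mem with ⟨-, rfl⟩ | hq
    exacts [rfl, absurd hq (Set.notMem_empty q)]
  · rcases h'.eq_empty_or_mem with ⟨rfl, -⟩ | hq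
    · exact absurd hp (Set.notMem_empty p)
    · rcases h.eq_or_strictBelow hq with h1 | h1
      · exact h1.symm
      · rcases h'.eq_or_strictBelow hp with h2 | h2
        · exact h2
        · exact absurd h1.1 h2.1.not_gt

theorem subset_Iic (h : SaturatedChain A p) : A ⊆ Set.Iic p := fun r hr => by
  rcases h.eq_or_strictBelow hr with rfl | h
  exacts [le_refl r, ⟨h.1.le, h.2.le⟩]

theorem finite (h : SaturatedChain A p) : A.Finite := (Set.finite_Iic p).subset h.subset_Iic

theorem notMem_of_chainStep (h : SaturatedChain A p) (hpq : ChainStep p q) : q ∉ A :=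
  fun hq => absurd (h.subset_Iic hq).1 hpq.1.1.not_ge

theorem mem_bounds (h : SaturatedChain A p) {r : ℕ × ℕ} (hr : r ∈ A) : 1 ≤ r.1 ∧ r.1 ≤ r.2 := by
  induction h with
  | empty => exact absurd hr (Set.notMem_empty r)
  | step hA hpq ih =>
    rcases hr with rfl | hr
    · exact ⟨(Nat.zero_le _).trans_lt hpq.1.1, hpq.2.1⟩
    · exact ih hr

theorem pairwise (h : SaturatedChain A p) {r s : ℕ × ℕ} (hr : r ∈ A) (hs : s ∈ A) (hne : r ≠ s) :
    StrictBelow r s ∨ StrictBelow s r := by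
  induction h with
  | empty => exact absurd hr (Set.notMem_empty r)
  | step hA hpq ih =>
    have h := hA.step hpq
    rcases hr with rfl | hr
    · exact Or.inr ((h.eq_or_strictBelow hs).resolve_left hne.symm)
    · rcases hs with rfl | hs
      · exact Or.inl ((h.eq_or_strictBelow (Or.inr hr)).resolve_left hne)
      · exact ih hr hs

/-- A saturated chain cannot be refined by a point which is not above its end. -/
theorem exists_not_strictBelow (h : SaturatedChain A p) {r : ℕ × ℕ} (h1 : 1 ≤ r.1)
    (h2 : r.1 ≤ r.2) (hr : ¬ StrictBelow p r) : ∃ a ∈ A, ¬ StrictBelow r a ∧ ¬ StrictBelow a r := by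
  induction h with
  | empty => exact absurd ⟨h1, h1.trans h2⟩ hr
  | @step A p q hA hpq ih =>
    by_cases hpr : StrictBelow p r
    · refine ⟨q, Set.mem_insert _ _, fun hrq => ?_, hr⟩
      obtain ⟨-, -, h | h⟩ := hpq
      · have := hpr.1.trans_le (Nat.lt_succ_iff.1 (h ▸ hrq.1))
        exact lt_irrefl _ this
      · have := hpr.2.trans_le (Nat.lt_succ_iff.1 (h ▸ hrq.2))
        exact lt_irrefl _ this
    · obtain ⟨a, ha, h⟩ := ih hpr
      exact ⟨a, Set.mem_insert_of_mem _ ha, h⟩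

end SaturatedChain

theorem finite_rootPairs (n : ℕ) : (rootPairs n).Finite :=
  (Set.finite_Iic ((2 * n, 2 * n) : ℕ × ℕ)).subset fun _ hp =>
    ⟨by have := hp.2.2; omega, by have := hp.2.2; omega⟩

/-- A maximal chain is saturated: if two of its consecutive points `p` and `q` were not related by
a step, then `p + (1, 1)` could be inserted between them. In the same way, if `p.1 + p.2 + 2 ≤ 2 * n`
for its last point `p`, then `p + (1, 1)` could be added at the end. -/
theorem SaturatedChain.of_mem_maxChains {n : ℕ} {A : Set (ℕ × ℕ)} (hA : A ∈ maxChains n) :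
    ∃ p, SaturatedChain A p ∧ p.1 + p.2 ≤ 2 * n ∧ 2 * n ≤ p.1 + p.2 + 1 := by
  obtain ⟨hsub, hpair, hmax⟩ := hA
  -- The chain is extended by the point `(0, 0)`, where its steps start.
  have hlt : ∀ p ∈ insert (0, 0) A, ∀ q ∈ A, p.1 < q.1 → StrictBelow p q := by
    rintro p (rfl | hp) q hq hpq
    · exact ⟨hpq, hpq.trans_le (hsub hq).2.1⟩
    · rcases hpair p hp q hq fun h => by simp [h] at hpq with h | h
      exacts [h, absurd h.1 hpq.not_gt]
  have heq : ∀ p ∈ A, ∀ q ∈ A, p.1 = q.1 → p = q := fun p hp q hq h => by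
    by_contra hne
    rcases hpair p hp q hq hne with h' | h'
    exacts [h'.1.ne h, h'.1.ne h.symm]
  -- The point of the chain which prevents adding `p + (1, 1)` comes after `p`.
  have hsucc : ∀ p ∈ insert (0, 0) A, (p.1 + 1, p.2 + 1) ∈ rootPairs n →
      ∃ a ∈ A, p.1 < a.1 ∧ ¬ StrictBelow (p.1 + 1, p.2 + 1) a := by
    intro p hp hr
    obtain ⟨a, ha, h1, h2⟩ := hmax _ hr
    refine ⟨a, ha, ?_, h1⟩
    by_contra! hle
    have hp' : p ∈ A := by
      rcases hp with rfl | hp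
      · exact absurd (hsub ha).1 (by dsimp only at hle; omega)
      · exact hp
    rcases hle.eq_or_lt with h | h
    · rw [heq a ha p hp' h] at h2
      exact h2 ⟨Nat.lt_succ_self _, Nat.lt_succ_self _⟩
    · have := hlt a (Or.inr ha) p hp' h
      exact h2 ⟨Nat.lt_succ_of_lt this.1, Nat.lt_succ_of_lt this.2⟩
  have hfin : (insert (0, 0) A).Finite := ((finite_rootPairs n).subset hsub).insert _
  have hsat : ∀ m, ∀ q ∈ insert (0, 0) A, q.1 = m → SaturatedChain {r | r ∈ A ∧ r.1 ≤ q.1} q := by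
    intro m
    induction m using Nat.strong_induction_on with
    | _ m ih =>
      rintro q (rfl | hq) rfl
      · convert SaturatedChain.empty
        rw [Set.eq_empty_iff_forall_notMem]
        rintro r ⟨hr, hr0⟩
        have := (hsub hr).1
        dsimp only at hr0
        omega
      · obtain ⟨p, ⟨hp, hpq⟩, hpmax⟩ :=
          Set.exists_max_image {r | r ∈ insert (0, 0) A ∧ r.1 < q.1} Prod.fst
            (hfin.subset fun r hr => hr.1) ⟨(0, 0), Or.inl rfl, (hsub hq).1⟩
        have hbelow := hlt p hp q hq hpq
        have hstep : ChainStep p q := by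
          refine ⟨hbelow, (hsub hq).2.1, ?_⟩
          by_contra! hne
          have hpq2 := hbelow.2
          have h1 := (hsub hq).2.2
          have h2 : p.1 ≤ p.2 := by
            rcases hp with rfl | hp
            exacts [le_rfl, (hsub hp).2.1]
          obtain ⟨a, ha, hpa, hna⟩ := hsucc p hp ⟨by omega, by dsimp only; omega,
            by dsimp only; omega⟩
          have haq : q.1 ≤ a.1 := by
            by_contra! h
            exact absurd (hpmax a ⟨Or.inr ha, h⟩) hpa.not_ge
          refine hna ⟨by dsimp only; omega, ?_⟩
          rcases haq.eq_or_lt with h | h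
          · rw [← heq q hq a ha h]
            dsimp only
            omega
          · have := (hlt q (Or.inr hq) a ha h).2
            dsimp only
            omega
        convert (ih p.1 hpq p hp rfl).step hstep using 1
        ext r
        constructor
        · rintro ⟨hr, hrq⟩
          rcases hrq.eq_or_lt with h | h
          · exact Or.inl (heq r hr q hq h)
          · exact Or.inr ⟨hr, hpmax r ⟨Or.inr hr, h⟩⟩
        · rintro (rfl | ⟨hr, hrp⟩)
          · exact ⟨hq, le_rfl⟩
          · exact ⟨hr, hrp.trans hpq.le⟩
  obtain ⟨p, hp, hpmax⟩ := Set.exists_max_image _ Prod.fst hfin ⟨(0, 0), Or.inl rfl⟩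
  refine ⟨p, ?_, ?_, ?_⟩
  · convert hsat _ p hp rfl using 1
    ext r
    exact ⟨fun hr => ⟨hr, hpmax r (Or.inr hr)⟩, fun hr => hr.1⟩
  · rcases hp with rfl | hp
    exacts [Nat.zero_le _, (hsub hp).2.2]
  · by_contra! h
    have h2 : p.1 ≤ p.2 := by
      rcases hp with rfl | hp
      exacts [le_rfl, (hsub hp).2.1]
    obtain ⟨a, ha, hpa, -⟩ := hsucc p hp ⟨by omega, by dsimp only; omega, by dsimp only; omega⟩
    exact absurd (hpmax a (Or.inr ha)) hpa.not_ge

theorem mem_maxChains_iff {n : ℕ} {A : Set (ℕ × ℕ)} :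
    A ∈ maxChains n ↔ ∃ p, SaturatedChain A p ∧ p.1 + p.2 ≤ 2 * n ∧ 2 * n ≤ p.1 + p.2 + 1 := by
  refine ⟨SaturatedChain.of_mem_maxChains, ?_⟩
  rintro ⟨p, h, h1, h2⟩
  refine ⟨fun r hr => ⟨(h.mem_bounds hr).1, (h.mem_bounds hr).2, ?_⟩,
    fun r hr s hs => h.pairwise hr hs,
    fun r hr => h.exists_not_strictBelow hr.1 hr.2.1 fun hpr => ?_⟩
  · have := h.subset_Iic hr
    exact (add_le_add this.1 this.2).trans h1
  · have h3 := hr.2.2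
    have h4 := hpr.1
    have h5 := hpr.2
    omega

/-- The polynomial `∑ y ^ #A`, where `A` runs over the saturated chains from `(0, 0)` to `p`. -/
noncomputable def chainPoly (p : ℕ × ℕ) : Polynomial ℤ :=
  ∑ᶠ A ∈ {A | SaturatedChain A p}, Polynomial.X ^ A.ncard

theorem finite_saturatedChains (p : ℕ × ℕ) : {A | SaturatedChain A p}.Finite :=
  (Set.finite_Iic p).finite_subsets.subset fun _ hA => hA.subset_Iic

theorem pairwiseDisjoint_saturatedChains (I : Set (ℕ × ℕ)) :
    I.PairwiseDisjoint fun p => {A | SaturatedChain A p} := fun _ _ _ _ hpq =>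
  Set.disjoint_left.2 fun _ hA hA' => hpq (SaturatedChain.end_unique hA hA')

theorem chainPoly_zero : chainPoly (0, 0) = 1 := by
  have : {A | SaturatedChain A (0, 0)} = {∅} := by
    ext A
    refine ⟨fun h => h.eq_empty_or_mem.elim And.left fun h0 => ?_, ?_⟩
    · exact absurd (SaturatedChain.mem_bounds h h0).1 (by simp)
    · rintro rfl
      exact .empty
  rw [chainPoly, this, finsum_mem_singleton, Set.ncard_empty, pow_zero]

theorem chainPoly_eq_zero {p : ℕ × ℕ} (hp : p ≠ (0, 0)) (h : p.1 = 0 ∨ p.2 < p.1) :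
    chainPoly p = 0 := by
  have : {A | SaturatedChain A p} = ∅ := by
    rw [Set.eq_empty_iff_forall_notMem]
    intro A hA
    rcases SaturatedChain.eq_empty_or_mem hA with ⟨-, h0⟩ | h0
    · exact hp h0
    · have := SaturatedChain.mem_bounds hA h0
      omega
  rw [chainPoly, this, finsum_mem_empty]

theorem chainPoly_eq_finsum {q : ℕ × ℕ} (hq : q ≠ (0, 0)) :
    chainPoly q = Polynomial.X * ∑ᶠ p ∈ {p | ChainStep p q}, chainPoly p := by
  have hfin : {p | ChainStep p q}.Finite :=
    (Set.finite_Iic q).subset fun p hp => ⟨hp.1.1.le, hp.1.2.le⟩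
  have hset : {A | SaturatedChain A q} =
      insert q '' ⋃ p ∈ {p | ChainStep p q}, {A | SaturatedChain A p} := by
    ext B
    simp only [Set.mem_ofPred_eq, Set.mem_image, Set.mem_iUnion, exists_prop]
    constructor
    · intro h
      cases h with
      | empty => exact absurd rfl hq
      | step hA hpq => exact ⟨_, ⟨_, hpq, hA⟩, rfl⟩
    · rintro ⟨A, ⟨p, hpq, hA⟩, rfl⟩
      exact hA.step hpq
  have hinj : Set.InjOn (insert q) (⋃ p ∈ {p | ChainStep p q}, {A | SaturatedChain A p}) := by
    intro A hA B hB h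
    simp only [Set.mem_ofPred_eq, Set.mem_iUnion, exists_prop] at hA hB
    obtain ⟨p, hp, hA⟩ := hA
    obtain ⟨p', hp', hB⟩ := hB
    rw [← Set.insert_sdiff_self_of_notMem (hA.notMem_of_chainStep hp), h,
      Set.insert_sdiff_self_of_notMem (hB.notMem_of_chainStep hp')]
  rw [chainPoly, hset, finsum_mem_image hinj,
    finsum_mem_biUnion (pairwiseDisjoint_saturatedChains _) hfin
      fun p _ => finite_saturatedChains p,
    mul_finsum_mem]
  refine finsum_mem_congr rfl fun p hp => ?_
  rw [chainPoly, mul_finsum_mem]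
  refine finsum_mem_congr rfl fun A hA => ?_
  rw [Set.ncard_insert_of_notMem (SaturatedChain.notMem_of_chainStep hA hp)
    (SaturatedChain.finite hA), pow_succ']

/-- The previous point of a saturated chain ending at `(a + 1, c + 1)` is on one of the lines with
first coordinate `a` and second coordinate `c`; the point `(a, c)` itself is counted once. -/
theorem chainPoly_succ {a c : ℕ} (h : a ≤ c) :
    chainPoly (a + 1, c + 1) = Polynomial.X *
      (∑ i ∈ Finset.range (c + 1), chainPoly (a, i) + ∑ i ∈ Finset.range a, chainPoly (i, c)) := by
  have hset : {p | ChainStep p (a + 1, c + 1)} =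
      ↑((Finset.range (c + 1)).image (fun i => (a, i)) ∪
        (Finset.range a).image fun i => (i, c)) := by
    ext ⟨b, d⟩
    simp only [ChainStep, StrictBelow, Set.mem_ofPred_eq, Finset.coe_union, Finset.coe_image,
      Set.mem_union, Set.mem_image, Finset.mem_coe, Finset.mem_range, Prod.mk.injEq]
    constructor
    · rintro ⟨⟨h1, h2⟩, -, h3⟩
      by_cases hb : b = a
      · exact Or.inl ⟨d, h2, hb.symm, rfl⟩
      · exact Or.inr ⟨b, by omega, rfl, by omega⟩
    · rintro (⟨i, hi, rfl, rfl⟩ | ⟨i, hi, rfl, rfl⟩) <;> omega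
  rw [chainPoly_eq_finsum (by simp), hset, finsum_mem_coe_finset, Finset.sum_union, Finset.sum_image,
    Finset.sum_image]
  · exact fun i _ j _ hij => (Prod.ext_iff.1 hij).1
  · exact fun i _ j _ hij => (Prod.ext_iff.1 hij).2
  · rw [Finset.disjoint_left]
    intro p hp hp'
    obtain ⟨i, -, rfl⟩ := Finset.mem_image.1 hp
    obtain ⟨j, hj, hj'⟩ := Finset.mem_image.1 hp'
    have := (Prod.ext_iff.1 hj').1
    have := Finset.mem_range.1 hj
    dsimp only at *
    omega

/-- The end points `(a, c)` have `a + c = 2 n` in the first sum and `a + c = 2 n - 1` in the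
second. -/
theorem popJB_eq_sum_chainPoly (n : ℕ) :
    popJB n = ∑ j ∈ Finset.range (n + 1), chainPoly (n - j, n + j) +
      ∑ j ∈ Finset.range n, chainPoly (n - 1 - j, n + j) := by
  have hset : maxChains n = ⋃ p ∈ (↑((Finset.range (n + 1)).image (fun j => (n - j, n + j)) ∪
      (Finset.range n).image fun j => (n - 1 - j, n + j)) : Set (ℕ × ℕ)),
        {A | SaturatedChain A p} := by
    ext A
    simp only [mem_maxChains_iff, Finset.coe_union, Finset.coe_image, Set.mem_iUnion, exists_prop,
      Set.mem_union, Set.mem_image, Finset.mem_coe, Finset.mem_range, Set.mem_ofPred_eq]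
    constructor
    · rintro ⟨⟨a, c⟩, h, h1, h2⟩
      have h3 := h.fst_le_snd
      refine ⟨(a, c), ?_, h⟩
      dsimp only at h1 h2 h3
      by_cases hs : a + c = 2 * n
      · exact Or.inl ⟨n - a, by omega, Prod.ext (by dsimp only; omega) (by dsimp only; omega)⟩
      · exact Or.inr ⟨c - n, by omega, Prod.ext (by dsimp only; omega) (by dsimp only; omega)⟩
    · rintro ⟨_, ⟨j, hj, rfl⟩ | ⟨j, hj, rfl⟩, h⟩ <;>
        exact ⟨_, h, by dsimp only; omega, by dsimp only; omega⟩
  rw [popJB_eq_finsum_maxChains, hset, finsum_mem_biUnion (pairwiseDisjoint_saturatedChains _)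
    (Finset.finite_toSet _) fun p _ => finite_saturatedChains p]
  change ∑ᶠ p ∈ _, chainPoly p = _
  rw [finsum_mem_coe_finset, Finset.sum_union, Finset.sum_image, Finset.sum_image]
  · exact fun i _ j _ hij => by simpa using (Prod.ext_iff.1 hij).2
  · exact fun i _ j _ hij => by simpa using (Prod.ext_iff.1 hij).2
  · rw [Finset.disjoint_left]
    intro p hp hp'
    obtain ⟨i, hi, rfl⟩ := Finset.mem_image.1 hp
    obtain ⟨j, hj, hj'⟩ := Finset.mem_image.1 hp'
    have h1 := (Prod.ext_iff.1 hj').1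
    have h2 := (Prod.ext_iff.1 hj').2
    rw [Finset.mem_range] at hi hj
    dsimp only at h1 h2
    omega

/-! ### The generating function -/

/-- The diagonal sum `∑ⱼ xʲ fⱼ` of a sequence of power series. -/
noncomputable def diagSum {R : Type*} [CommRing R] (f : ℕ → PowerSeries R) : PowerSeries R :=
  PowerSeries.mk fun n => ∑ j ∈ Finset.range (n + 1), PowerSeries.coeff (n - j) (f j)

section DiagSum

variable {R : Type*} [CommRing R]

theorem diagSum_eq_add (f : ℕ → PowerSeries R) :
    diagSum f = f 0 + PowerSeries.X * diagSum fun j => f (j + 1) := by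
  ext n
  cases n with
  | zero => simp [diagSum]
  | succ n =>
    rw [map_add, PowerSeries.coeff_succ_X_mul, diagSum, diagSum, PowerSeries.coeff_mk,
      PowerSeries.coeff_mk, Finset.sum_range_succ', add_comm]
    simp

theorem diagSum_add (f g : ℕ → PowerSeries R) :
    diagSum (fun j => f j + g j) = diagSum f + diagSum g := by
  ext n
  simp [diagSum, Finset.sum_add_distrib]

theorem PowerSeries.eq_zero_of_eq_X_mul {d : ℕ → PowerSeries R}
    (hd : ∀ j, d j = PowerSeries.X * d (j + 1)) (j : ℕ) : d j = 0 := by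
  ext n
  induction n generalizing j with
  | zero => rw [hd, PowerSeries.coeff_zero_X_mul, map_zero]
  | succ n ih => rw [hd, PowerSeries.coeff_succ_X_mul, ih, map_zero, map_zero]

/-- Iterating `diagSum_eq_add` shows that the difference of the two sides is divisible by all powers
of the variable. -/
theorem diagSum_mul (c : PowerSeries R) (f : ℕ → PowerSeries R) :
    diagSum (fun j => c * f j) = c * diagSum f := by
  refine sub_eq_zero.1 (PowerSeries.eq_zero_of_eq_X_mul
    (d := fun k => diagSum (fun j => c * f (j + k)) - c * diagSum fun j => f (j + k))
    (fun k => ?_) 0)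
  rw [diagSum_eq_add fun j => c * f (j + k), diagSum_eq_add fun j => f (j + k)]
  simp only [zero_add, add_right_comm _ 1 k, add_assoc]
  ring

end DiagSum

/-- The generating function `∑ₐ F (a, a + h) xᵃ` of the saturated chains which end at height `h`
above the diagonal. -/
noncomputable def heightSeries (h : ℕ) : PowerSeries (Polynomial ℤ) :=
  PowerSeries.mk fun a => chainPoly (a, a + h)

/-- The generating function of the saturated chains which end at height at most `h`. -/
noncomputable def lowSeries (h : ℕ) : PowerSeries (Polynomial ℤ) :=
  ∑ i ∈ Finset.range (h + 1), heightSeries i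

/-- The generating function of the chains which end on the same horizontal line as, and to the left
of, the point of height `h` with first coordinate `a`, marked by `xᵃ`. -/
noncomputable def leftSeries (h : ℕ) : PowerSeries (Polynomial ℤ) :=
  PowerSeries.mk fun a => ∑ i ∈ Finset.range a, chainPoly (i, a + h)

/-- A chain is empty or has a last step, which comes from the vertical line `lowSeries` or from the
horizontal line `leftSeries`. -/
theorem heightSeries_eq (h : ℕ) : heightSeries h =
    (if h = 0 then 1 else 0) + serX * serY * (lowSeries h + leftSeries h) := by
  ext1 n
  rw [map_add, serX, serY, mul_assoc]
  cases n with
  | zero =>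
    rw [PowerSeries.coeff_zero_X_mul, add_zero, heightSeries, PowerSeries.coeff_mk, zero_add]
    split_ifs with hh
    · rw [hh, chainPoly_zero, PowerSeries.coeff_zero_one]
    · rw [chainPoly_eq_zero (by simpa using hh) (Or.inl rfl), map_zero]
  | succ a =>
    have h0 : PowerSeries.coeff (a + 1)
        (if h = 0 then 1 else 0 : PowerSeries (Polynomial ℤ)) = 0 := by
      split_ifs
      · rw [PowerSeries.coeff_one, if_neg (Nat.succ_ne_zero a)]
      · exact map_zero _
    rw [PowerSeries.coeff_succ_X_mul, PowerSeries.coeff_C_mul, h0, zero_add, map_add,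
      heightSeries, PowerSeries.coeff_mk, add_right_comm, chainPoly_succ (Nat.le_add_right a h),
      leftSeries, PowerSeries.coeff_mk, lowSeries, map_sum, add_assoc a h 1, Finset.sum_range_add,
      Finset.sum_eq_zero (s := Finset.range a) fun i hi => chainPoly_eq_zero
        (fun h => ?_) (Or.inr (Finset.mem_range.1 hi)), zero_add]
    · simp only [heightSeries, PowerSeries.coeff_mk]
    · have := Finset.mem_range.1 hi
      have := congrArg Prod.fst h
      dsimp only at this
      omega

theorem lowSeries_zero : lowSeries 0 = heightSeries 0 := by
  simp [lowSeries]

theorem lowSeries_succ (h : ℕ) : lowSeries (h + 1) = lowSeries h + heightSeries (h + 1) :=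
  Finset.sum_range_succ _ _

theorem leftSeries_eq (h : ℕ) :
    leftSeries h = serX * (leftSeries (h + 1) + heightSeries (h + 1)) := by
  ext1 n
  rw [serX]
  cases n with
  | zero => rw [PowerSeries.coeff_zero_X_mul, leftSeries, PowerSeries.coeff_mk,
      Finset.sum_range_zero]
  | succ a =>
    rw [PowerSeries.coeff_succ_X_mul, map_add, leftSeries, leftSeries, heightSeries,
      PowerSeries.coeff_mk, PowerSeries.coeff_mk, PowerSeries.coeff_mk, Finset.sum_range_succ,
      add_right_comm a 1 h, add_assoc a h 1]

/-- The series `1 + x - x y (1 - x)`, which governs the recursion on the height. -/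
noncomputable def kernelSeries : PowerSeries (Polynomial ℤ) :=
  1 + serX - serX * serY * (1 - serX)

/-- Away from the boundary, `x H_{h+1} + H_{h-1} = B H_h` for the series `H_h` of chains ending at
height `h`. -/
theorem heightSeries_rec (h : ℕ) : serX * heightSeries (h + 2) + heightSeries h =
    kernelSeries * heightSeries (h + 1) + if h = 0 then 1 else 0 := by
  have e0 := heightSeries_eq h
  have e1 := heightSeries_eq (h + 1)
  have e2 := heightSeries_eq (h + 2)
  rw [if_neg (by omega)] at e1 e2
  have l1 := lowSeries_succ h
  have l2 := lowSeries_succ (h + 1)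
  have r0 := leftSeries_eq h
  have r1 := leftSeries_eq (h + 1)
  rw [kernelSeries]
  linear_combination serX * e2 + e0 - (1 + serX) * e1 + serX * serY * (r0 - r1) +
    serX * serY * (serX * l2 - l1)

theorem heightSeries_rec_zero :
    serX * heightSeries 1 + serX * heightSeries 0 + 1 = kernelSeries * heightSeries 0 := by
  have e0 := heightSeries_eq 0
  have e1 := heightSeries_eq 1
  rw [if_neg one_ne_zero] at e1
  rw [if_pos rfl] at e0
  have l0 := lowSeries_zero
  have l1 := lowSeries_succ 0
  have r0 := leftSeries_eq 0
  rw [kernelSeries]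
  linear_combination serX * e1 - e0 - serX * serY * r0 + serX * serY * (serX * l1 + serX * l0 - l0)

theorem lowSeries_rec_zero : serX * lowSeries 1 + 1 = kernelSeries * lowSeries 0 := by
  linear_combination heightSeries_rec_zero + serX * lowSeries_succ 0 +
    (serX - kernelSeries) * lowSeries_zero

/-- The recursion without boundary term: the partial sums of the `H_h` are its solution with the
additional initial value `1`, see `lowSeries_rec_zero`. -/
theorem lowSeries_rec (h : ℕ) :
    serX * lowSeries (h + 2) + lowSeries h = kernelSeries * lowSeries (h + 1) := by
  induction h with
  | zero =>
    have := heightSeries_rec 0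
    rw [if_pos rfl] at this
    linear_combination this + serX * lowSeries_succ 1 - kernelSeries * lowSeries_succ 0 +
      lowSeries_rec_zero + lowSeries_zero
  | succ h ih =>
    have := heightSeries_rec (h + 1)
    rw [if_neg (by omega)] at this
    linear_combination ih + this + serX * lowSeries_succ (h + 2) -
      kernelSeries * lowSeries_succ (h + 1) + lowSeries_succ h

/-- The quadratic form `x u² + t² - B t u` of two consecutive terms `t`, `u` of a solution of the
recursion is divisible by all powers of `x`. This replaces the choice of the root of the kernel
which is a power series, and gives the quadratic equation of the series of closed excursions. -/
theorem heightSeries_zero_quadratic :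
    serX * heightSeries 0 ^ 2 - kernelSeries * heightSeries 0 + 1 = 0 := by
  have h := PowerSeries.eq_zero_of_eq_X_mul (d := fun h => serX * lowSeries (h + 1) ^ 2 +
    lowSeries h ^ 2 - kernelSeries * lowSeries h * lowSeries (h + 1)) (fun h => by
      change _ = serX * _
      linear_combination (lowSeries h - serX * lowSeries (h + 2)) * lowSeries_rec h) 0
  rw [← lowSeries_zero]
  linear_combination serX * h + (1 - serX * lowSeries 1) * lowSeries_rec_zero

/-- The series is the sum over the final heights `h` of `x ^ ⌈h / 2⌉ H_h`. -/
theorem popJBSeries_eq : popJBSeries = diagSum (fun j => heightSeries (2 * j)) +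
    serX * diagSum fun j => heightSeries (2 * j + 1) := by
  ext1 n
  rw [map_add, popJBSeries, PowerSeries.coeff_mk, popJB_eq_sum_chainPoly, serX]
  have h1 : PowerSeries.coeff n (diagSum fun j => heightSeries (2 * j)) =
      ∑ j ∈ Finset.range (n + 1), chainPoly (n - j, n + j) := by
    rw [diagSum, PowerSeries.coeff_mk]
    refine Finset.sum_congr rfl fun j hj => ?_
    have := Finset.mem_range.1 hj
    rw [heightSeries, PowerSeries.coeff_mk, show n - j + 2 * j = n + j by omega]
  rw [h1]
  congr 1
  cases n with
  | zero => rw [PowerSeries.coeff_zero_X_mul, Finset.sum_range_zero]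
  | succ n =>
    rw [PowerSeries.coeff_succ_X_mul, diagSum, PowerSeries.coeff_mk, Nat.add_sub_cancel]
    refine Finset.sum_congr rfl fun j hj => ?_
    have := Finset.mem_range.1 hj
    rw [heightSeries, PowerSeries.coeff_mk, show n - j + (2 * j + 1) = n + 1 + j by omega]

/-- With `U` and `V` the sums over the even and the odd heights, so that the series is `U + x V`, the
recursion gives two linear equations for `U` and `V`, with coefficients involving `H_0` only. -/
theorem popJBSeries_mul : popJBSeries * (4 * serX - kernelSeries ^ 2) =
    (1 - serX) * (2 * serX * heightSeries 0 - kernelSeries) := by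
  set U := diagSum fun j => heightSeries (2 * j) with hU
  set V := diagSum fun j => heightSeries (2 * j + 1) with hV
  have hU1 : U = heightSeries 0 + serX * diagSum fun j => heightSeries (2 * j + 2) :=
    diagSum_eq_add _
  have hV1 : V = heightSeries 1 + serX * diagSum fun j => heightSeries (2 * j + 3) :=
    diagSum_eq_add _
  have hU2 : (diagSum fun j => heightSeries (2 * j + 2)) =
      heightSeries 2 + serX * diagSum fun j => heightSeries (2 * j + 4) :=
    diagSum_eq_add _
  -- The recursion at the even heights, and at the odd heights greater than one, is summed up.
  have hE : serX * (diagSum fun j => heightSeries (2 * j + 3)) + V =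
      kernelSeries * diagSum fun j => heightSeries (2 * j + 2) := by
    rw [← diagSum_mul, ← diagSum_mul, ← diagSum_add]
    refine congrArg _ (funext fun j => ?_)
    have := heightSeries_rec (2 * j + 1)
    rwa [if_neg (by omega), add_zero] at this
  have hO : serX * (diagSum fun j => heightSeries (2 * j + 4)) +
      (diagSum fun j => heightSeries (2 * j + 2)) =
      kernelSeries * diagSum fun j => heightSeries (2 * j + 3) := by
    rw [← diagSum_mul, ← diagSum_mul, ← diagSum_add]
    refine congrArg _ (funext fun j => ?_)
    have := heightSeries_rec (2 * j + 2)
    rwa [if_neg (by omega), add_zero] at this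
  have h0 := heightSeries_rec_zero
  have h1 := heightSeries_rec 0
  rw [if_pos rfl] at h1
  have e1 : 2 * serX * V - kernelSeries * U = -(serX * heightSeries 0 + 1) := by
    linear_combination serX * hE + serX * hV1 - kernelSeries * hU1 + h0
  have e2 : 2 * U - kernelSeries * V = heightSeries 0 + 1 := by
    linear_combination serX * hO + 2 * hU1 - kernelSeries * hV1 + h1 + serX * hU2
  rw [popJBSeries_eq]
  linear_combination kernelSeries * e1 + 2 * serX * e2 +
    serX * (2 * e1 + kernelSeries * e2)

theorem serX_ne_one : (serX : PowerSeries (Polynomial ℤ)) ≠ 1 := fun h => by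
  have := congrArg (PowerSeries.coeff 0) h
  simp [serX] at this

theorem popJBSeries_sq_mul :
    popJBSeries ^ 2 * (kernelSeries ^ 2 - 4 * serX) = (1 - serX) ^ 2 := by
  have hne : kernelSeries ^ 2 - 4 * serX ≠ 0 := fun h => by
    have := congrArg (PowerSeries.coeff 0) h
    simp [serX, kernelSeries] at this
  refine mul_right_cancel₀ hne ?_
  linear_combination (popJBSeries * (4 * serX - kernelSeries ^ 2) +
    (1 - serX) * (2 * serX * heightSeries 0 - kernelSeries)) * popJBSeries_mul +
    4 * serX * (1 - serX) ^ 2 * heightSeries_zero_quadratic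

theorem one_sub_serX_mul_serZ : (1 - serX) * serZ = -(serX * serY) := by
  have := Ring.mul_inverse_cancel _ isUnit_serX_sub_one
  rw [serZ]
  linear_combination -(serX * serY) * this

theorem isInvSqrt_popJBSeries : IsInvSqrt (serW ^ 2 + 4 * serZ) popJBSeries := by
  constructor
  · have h := congrArg PowerSeries.constantCoeff popJBSeries_eq
    rw [h, serX, map_add, map_mul, PowerSeries.constantCoeff_X, zero_mul, add_zero,
      diagSum_eq_add, map_add, map_mul, PowerSeries.constantCoeff_X, zero_mul, add_zero,
      ← PowerSeries.coeff_zero_eq_constantCoeff_apply]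
    exact (PowerSeries.coeff_mk _ _).trans chainPoly_zero
  · have hne : (1 - serX) ^ 2 ≠ 0 := pow_ne_zero _ (sub_ne_zero.2 serX_ne_one.symm)
    refine mul_right_cancel₀ hne ?_
    have h := popJBSeries_sq_mul
    rw [kernelSeries] at h
    rw [serW]
    linear_combination h + 4 * popJBSeries ^ 2 * (1 - serX) * one_sub_serX_mul_serZ

/-! ### The coefficients -/

section CentralBinom

variable (R : Type*) [CommRing R]

/-- The generating function `∑ⱼ (2j choose j) Xʲ` of the central binomial coefficients. -/
noncomputable def centralBinomSeries : PowerSeries R := PowerSeries.mk fun j => (j.centralBinom : R)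

theorem one_sub_four_X_mul_derivative_centralBinomSeries : (1 - 4 * PowerSeries.X) *
    PowerSeries.derivative R (centralBinomSeries R) = 2 * centralBinomSeries R := by
  have h4 : (4 : PowerSeries R) = PowerSeries.C 4 := rfl
  have h2 : (2 : PowerSeries R) = PowerSeries.C 2 := rfl
  ext n
  rw [sub_mul, one_mul, map_sub, h4, h2, mul_assoc, PowerSeries.coeff_C_mul,
    PowerSeries.coeff_C_mul, PowerSeries.coeff_derivative]
  cases n with
  | zero => simp [centralBinomSeries, Nat.centralBinom]
  | succ n =>
    rw [PowerSeries.coeff_succ_X_mul, PowerSeries.coeff_derivative, centralBinomSeries,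
      PowerSeries.coeff_mk, PowerSeries.coeff_mk]
    have := congrArg (Nat.cast (R := R)) (Nat.succ_mul_centralBinom_succ (n + 1))
    push_cast at this ⊢
    linear_combination this

/-- The binomial series of `(1 - 4 X) ^ (-1/2)`: its square times `1 - 4 X` has derivative `0`. -/
theorem centralBinomSeries_sq_mul [IsAddTorsionFree R] :
    centralBinomSeries R ^ 2 * (1 - 4 * PowerSeries.X) = 1 := by
  have h4 : (4 : PowerSeries R) = PowerSeries.C 4 := rfl
  apply PowerSeries.derivative.ext
  · have h := one_sub_four_X_mul_derivative_centralBinomSeries R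
    rw [Derivation.leibniz, Derivation.leibniz_pow, map_sub, Derivation.leibniz, h4,
      PowerSeries.derivative_C, PowerSeries.derivative_X, PowerSeries.derivative_one, ← h4]
    simp only [smul_eq_mul, nsmul_eq_mul]
    push_cast
    linear_combination 2 * centralBinomSeries R * h
  · simp [centralBinomSeries]

end CentralBinom

/-- The sum `∑ⱼ fⱼ (X g)ʲ` as a diagonal sum. -/
theorem PowerSeries.subst_X_mul {R : Type*} [CommRing R] (f g : PowerSeries R) :
    f.subst (PowerSeries.X * g : PowerSeries R) =
      diagSum fun j => PowerSeries.C (PowerSeries.coeff j f) * g ^ j := by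
  have hs : PowerSeries.HasSubst (PowerSeries.X * g : PowerSeries R) :=
    PowerSeries.HasSubst.of_constantCoeff_zero' (by simp)
  ext n
  rw [PowerSeries.coeff_subst' hs, finsum_eq_sum_of_support_subset (s := Finset.range (n + 1)),
    diagSum, PowerSeries.coeff_mk]
  · refine Finset.sum_congr rfl fun j hj => ?_
    have hj : j ≤ n := Nat.lt_succ_iff.1 (Finset.mem_range.1 hj)
    rw [mul_pow, PowerSeries.coeff_X_pow_mul', if_pos hj, PowerSeries.coeff_C_mul, smul_eq_mul]
  · intro j hj
    by_contra hjn
    rw [Finset.coe_range, Set.mem_Iio, not_lt] at hjn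
    refine hj ?_
    dsimp only
    rw [mul_pow, PowerSeries.coeff_X_pow_mul', if_neg (by omega), smul_zero]

/-- The geometric series `1 / (1 - x)`. -/
noncomputable def geomX : PowerSeries (Polynomial ℤ) := PowerSeries.mk 1

/-- The geometric series `1 / (1 + x y)`. -/
noncomputable def geomW : PowerSeries (Polynomial ℤ) := PowerSeries.rescale (-Polynomial.X) geomX

theorem geomX_mul : geomX * (1 - serX) = 1 := PowerSeries.mk_one_mul_one_sub_eq_one _

theorem geomW_mul : geomW * serW = 1 := by
  have h := congrArg (PowerSeries.rescale (-Polynomial.X)) geomX_mul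
  rw [map_mul, map_sub, map_one, serX, PowerSeries.rescale_X] at h
  rw [geomW, ← h, serW, serX, serY, map_neg]
  ring

theorem coeff_geomX_pow (j q : ℕ) : PowerSeries.coeff q (geomX ^ j) =
    Polynomial.C (Ring.choose ((q : ℤ) + (j : ℤ) - 1) q) := by
  cases j with
  | zero =>
    rw [pow_zero, PowerSeries.coeff_one]
    cases q with
    | zero => simp
    | succ q =>
      have : ((q + 1 : ℕ) : ℤ) + ((0 : ℕ) : ℤ) - 1 = (q : ℕ) := by push_cast; ring
      rw [this, Ring.choose_natCast, Nat.choose_succ_self, if_neg (Nat.succ_ne_zero q)]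
      simp
  | succ j =>
    have : (q : ℤ) + ((j + 1 : ℕ) : ℤ) - 1 = ((j + q : ℕ) : ℤ) := by push_cast; ring
    rw [geomX, PowerSeries.mk_one_pow_eq_mk_choose_add, PowerSeries.coeff_mk, this,
      Ring.choose_natCast, Nat.choose_symm_add]
    simp

theorem coeff_geomW_pow (d p : ℕ) : PowerSeries.coeff p (geomW ^ (d + 1)) =
    Polynomial.C ((-1) ^ p * ((d + p).choose p : ℤ)) * Polynomial.X ^ p := by
  rw [geomW, ← map_pow, PowerSeries.coeff_rescale, geomX,
    PowerSeries.mk_one_pow_eq_mk_choose_add, PowerSeries.coeff_mk, Nat.choose_symm_add, neg_pow]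
  simp only [map_mul, map_pow, map_neg, map_one, map_natCast]
  ring

/-- The binomial expansion of `w⁻¹ (1 + 4 z / w ^ 2) ^ (-1/2)`. -/
theorem popJBSeries_eq_diagSum : popJBSeries = diagSum fun j =>
    geomW * (PowerSeries.C (j.centralBinom : Polynomial ℤ) * (serY * geomX * geomW ^ 2) ^ j) := by
  set g := serY * geomX * geomW ^ 2 with hg
  have hs : PowerSeries.HasSubst (PowerSeries.X * g) :=
    PowerSeries.HasSubst.of_constantCoeff_zero' (by simp)
  have hsub := PowerSeries.subst_X_mul (centralBinomSeries (Polynomial ℤ)) g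
  simp only [centralBinomSeries, PowerSeries.coeff_mk] at hsub
  rw [diagSum_mul, ← hsub]
  refine isInvSqrt_popJBSeries.unique ⟨?_, ?_⟩
  · rw [map_mul, hsub, diagSum_eq_add]
    have hW : PowerSeries.constantCoeff geomW = 1 := by
      rw [geomW, ← PowerSeries.coeff_zero_eq_constantCoeff_apply, PowerSeries.coeff_rescale, geomX,
        PowerSeries.coeff_mk, pow_zero, one_mul, Pi.one_apply]
    simp [hW]
  · have h := congrArg (PowerSeries.substAlgHom hs) (centralBinomSeries_sq_mul (Polynomial ℤ))
    rw [map_mul, map_pow, map_sub, map_mul, map_one, map_ofNat, PowerSeries.substAlgHom_X,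
      PowerSeries.coe_substAlgHom, centralBinomSeries] at h
    set S := PowerSeries.subst (PowerSeries.X * g)
      (PowerSeries.mk fun j => (j.centralBinom : Polynomial ℤ))
    have hX : (PowerSeries.X : PowerSeries (Polynomial ℤ)) = serX := rfl
    rw [hX] at h
    have hz : serZ = -(serX * serY * geomX) := by
      linear_combination geomX * one_sub_serX_mul_serZ - serZ * geomX_mul
    have hw : (geomW * serW) ^ 2 = 1 := by rw [geomW_mul, one_pow]
    rw [hz]
    linear_combination h + S ^ 2 * hw

theorem coeff_coeff_popJBSeries (n k : ℕ) : (PowerSeries.coeff n popJBSeries).coeff k =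
    ∑ j ∈ Finset.range (n + 1), ∑ p ∈ Finset.HasAntidiagonal.antidiagonal (n - j),
      if k = j + p.2 then (j.centralBinom : ℤ) * ((-1) ^ p.2 * ((2 * j + p.2).choose p.2 : ℤ)) *
        Ring.choose ((p.1 : ℤ) + (j : ℤ) - 1) p.1 else 0 := by
  rw [popJBSeries_eq_diagSum, diagSum, PowerSeries.coeff_mk, Polynomial.finsetSum_coeff]
  refine Finset.sum_congr rfl fun j _ => ?_
  have : geomW * (PowerSeries.C (j.centralBinom : Polynomial ℤ) *
      (serY * geomX * geomW ^ 2) ^ j) =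
      PowerSeries.C (Polynomial.C (j.centralBinom : ℤ) * Polynomial.X ^ j) *
        (geomX ^ j * geomW ^ (2 * j + 1)) := by
    rw [serY, map_mul, map_pow, map_natCast, map_natCast, map_natCast]
    ring
  rw [this, PowerSeries.coeff_C_mul, PowerSeries.coeff_mul, Finset.mul_sum,
    Polynomial.finsetSum_coeff]
  refine Finset.sum_congr rfl fun p _ => ?_
  rw [coeff_geomX_pow, coeff_geomW_pow, ← Polynomial.coeff_C_mul_X_pow]
  congr 1
  simp only [map_mul]
  ring

theorem mainTheorem6 :
    IsInvSqrt (serW ^ 2 + 4 * serZ) popJBSeries ∧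
    (∀ n k : ℕ, k ≤ n →
      (PowerSeries.coeff n popJBSeries).coeff k =
        ∑ j ∈ Finset.range (k + 1),
          (-1 : ℤ) ^ (k - j) * (Nat.choose (2 * j) j : ℤ) * (Nat.choose (k + j) (k - j) : ℤ) *
            Ring.choose ((n : ℤ) - (k : ℤ) + (j : ℤ) - 1) (n - k)) ∧
    (∀ n k : ℕ, n < k → (PowerSeries.coeff n popJBSeries).coeff k = 0) := by
  refine ⟨isInvSqrt_popJBSeries, fun n k hkn => ?_, fun n k hnk => ?_⟩
  · rw [coeff_coeff_popJBSeries]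
    symm
    refine Finset.sum_subset_zero_on_sdiff (Finset.range_mono (by omega)) (fun j hj => ?_)
      fun j hj => ?_
    · rw [Finset.mem_sdiff, Finset.mem_range, Finset.mem_range] at hj
      exact Finset.sum_eq_zero fun p _ => if_neg (by omega)
    · have hjk : j ≤ k := Nat.lt_succ_iff.1 (Finset.mem_range.1 hj)
      rw [Finset.sum_eq_single (n - k, k - j)]
      · rw [if_pos (by dsimp only; omega), Nat.centralBinom]
        dsimp only
        rw [show 2 * j + (k - j) = k + j by omega, Nat.cast_sub hkn]
        ring
      · intro p hp hne
        rw [Finset.HasAntidiagonal.mem_antidiagonal] at hp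
        exact if_neg fun h => hne (Prod.ext (by dsimp only; omega) (by dsimp only; omega))
      · intro h
        exact absurd (Finset.HasAntidiagonal.mem_antidiagonal.2 (by dsimp only; omega)) h
  · rw [coeff_coeff_popJBSeries]
    refine Finset.sum_eq_zero fun j hj => Finset.sum_eq_zero fun p hp => if_neg ?_
    rw [Finset.HasAntidiagonal.mem_antidiagonal] at hp
    rw [Finset.mem_range] at hj
    omega
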